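/- \textbf{The potential game.} Let $\alpha,\beta,\rho>0$ and $c\ge 0$. In the $(\alpha,\beta,c,\rho)$-game on $\mathbb{R}$, Alice and Bob play as follows. On each turn $m=0,1,2,\dots$ Bob plays first, choosing a closed ball $B_m=B[x_m,\rho_m]$ with $\rho_m>0$, subject to $\rho_0\ge\rho$, to $\rho_m\ge\beta\rho_{m-1}$ and $B_m\subseteq B_{m-1}$ for all $m\ge 1$, and to $\lim_{m\to\infty}\rho_m=0$. Alice then responds by erasing a finite (possibly empty) or countably infinite collection $\mathcal{A}_m$ of closed balls of radii $\rho_{i,m}>0$ such that $\sum_i\rho_{i,m}^c\le(\alpha\rho_m)^c$ if $c>0$; if $c=0$, the collection contains at most one ball, of radius at most $\alpha\rho_m$. The outcome of the game is the unique point $x_\infty$ of $\bigcap_m B_m$. A set $S\subset\mathbb{R}$ is \emph{$(\alpha,\beta,c,\rho)$-winning} if Alice has a strategy (a rule determining each legal answer from the balls Bob has played so far) guaranteeing that $x_\infty\in S$ whenever $x_\infty$ lies in none of the erased balls. \textbf{Theorem.} Let $\alpha,\rho>0$, $0<c<1$ and $0<\beta\le\frac14$, and let $S\subset\mathbb{R}$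 be an $(\alpha,\beta,c,\rho)$-winning set. If $$\alpha^c\le\frac{1}{720^2}\left(1-\beta^{1-c}\right),$$ then for every ball $B_0\subset\mathbb{R}$ (open or closed) of radius at least $\rho$, $$\dim_{\rm H}(S\cap B_0)\ \ge\ 1-\frac{1440\,\alpha\log 6}{|\log\beta|}\ >\ 0 .$$ -/

import Mathlib

open Set Filter Topology
open scoped ENNReal

/-- A ball of the real line, recorded as the pair (centre, radius). It stands for the closed
interval `Metric.closedBall p.1 p.2`. -/
abbrev GameBall : Type := ℝ × ℝ

/-- The set of points of a ball of the game. -/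
def GameBall.points (p : GameBall) : Set ℝ := Metric.closedBall p.1 p.2

/-- `B 0, B 1, …` is a legal sequence of moves of Bob in the potential game with parameters
`β` and `ρ`: genuine nested closed balls, the first one of radius at least `ρ`, each radius at
least `β` times the preceding one, with radii tending to `0`. -/
def IsLegalBobPlay (β ρ : ℝ) (B : ℕ → GameBall) : Prop :=
  (∀ m, 0 < (B m).2) ∧
  ρ ≤ (B 0).2 ∧
  (∀ m, β * (B m).2 ≤ (B (m + 1)).2) ∧
  (∀ m, (B (m + 1)).points ⊆ (B m).points) ∧
  Tendsto (fun m => (B m).2) atTop (𝓝 0)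

/-- `A` is a legal collection of balls for Alice to erase when Bob's last ball has radius `r`:
a finite (possibly empty) or countably infinite collection of balls of positive radii `ρᵢ` with
`∑ᵢ ρᵢ ^ c ≤ (α r) ^ c` if `c > 0`, and at most one ball, of radius at most `α r`, if `c = 0`.
The sum is taken in `[0, ∞]`, so the inequality includes its convergence. -/
def IsLegalErasure (α c r : ℝ) (A : Set GameBall) : Prop :=
  A.Countable ∧
  (∀ p ∈ A, 0 < p.2) ∧
  (0 < c → ∑' p : A, ENNReal.ofReal ((p : GameBall).2 ^ c) ≤ ENNReal.ofReal ((α * r) ^ c)) ∧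
  (c = 0 → A.Subsingleton ∧ ∀ p ∈ A, p.2 ≤ α * r)

/-- A strategy of Alice: her answer as a function of the list `[B₀, …, Bₘ]` of all the balls that
Bob has played so far. -/
abbrev AliceStrategy : Type := List GameBall → Set GameBall

/-- The collection that Alice erases on turn `m`, if she follows `σ` and Bob plays `B`. -/
def AliceStrategy.answer (σ : AliceStrategy) (B : ℕ → GameBall) (m : ℕ) : Set GameBall :=
  σ ((List.range (m + 1)).map B)

/-- `S` is an `(α, β, c, ρ)`-winning set of the potential game on the real line: Alice has a
strategy, all of whose answers to legal play of Bob are legal, such that the outcome of the game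
(the common point of all of Bob's balls) lies in `S` unless Alice has erased it. -/
def IsPotentialWinning (α β c ρ : ℝ) (S : Set ℝ) : Prop :=
  ∃ σ : AliceStrategy, ∀ B : ℕ → GameBall, IsLegalBobPlay β ρ B →
    (∀ m, IsLegalErasure α c (B m).2 (σ.answer B m)) ∧
    ∀ x : ℝ, (∀ m, x ∈ (B m).points) →
      x ∉ ⋃ m, ⋃ p ∈ σ.answer B m, p.points → x ∈ S

/-! Let Bob play only inside the `q`-adic grid of the given ball, with `q = ⌊1 / β⌋`. Alice's
strategy then attaches to each node of a `q`-ary tree a collection of erased balls. Call a node good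
if the balls erased at its strict ancestors and still meeting its cell, of radius `r`, have total
`c`-weight at most `(γ r) ^ c`, where `γ = 1 / 8`.

Counting (`card_large_potential_le`, `large_potential_bound_le_half`): with `N` about `1 / (8 α)`,
at most half of the `q ^ N` descendants of a good node, `N` generations later, are bad. Inherited
balls cover a proportion of about `γ`, and newly erased ones about `N α`; boundary effects are
geometric sums in `q ^ (c - 1)`, which the hypothesis on `α ^ c` makes negligible.

Survival (`treeLimitSet_smallPotential_subset`): if every `N`-th node around a point is good, an
erased ball containing the point would have radius at most `γ r` for arbitrarily small `r`, which is
absurd. So the point lies in `S`.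

Dimension (`le_dimH_treeLimitSet`): keeping indices of one parity leaves about `q ^ N / 4` separated
good descendants of each good node, so the limit set has dimension at least `1 - log 6 / (N log q)`.
-/

/-! ### Geometry of the grid -/

/-- The `k`-th of the `q ^ n` consecutive balls of equal length that tile the ball `b`. -/
noncomputable def gridBall (q : ℕ) (b : GameBall) (n k : ℕ) : GameBall :=
  (b.1 - b.2 + b.2 * (2 * k + 1) / (q : ℝ) ^ n, b.2 / (q : ℝ) ^ n)

theorem mem_points_gridBall {q : ℕ} (hq : 0 < q) (b : GameBall) (n k : ℕ) (y : ℝ) :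
    y ∈ (gridBall q b n k).points ↔
      b.1 - b.2 + 2 * (b.2 / (q : ℝ) ^ n) * k ≤ y ∧
        y ≤ b.1 - b.2 + 2 * (b.2 / (q : ℝ) ^ n) * (k + 1) := by
  have hqn : (0 : ℝ) < (q : ℝ) ^ n := by positivity
  have h1 : b.2 * (2 * (k : ℝ) + 1) / (q : ℝ) ^ n = b.2 / (q : ℝ) ^ n * (2 * k + 1) := by ring
  rw [GameBall.points, Real.closedBall_eq_Icc, gridBall, mem_Icc]
  dsimp only
  rw [h1]
  constructor <;> rintro ⟨h, h'⟩ <;> constructor <;> linarith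

theorem gridBall_zero (q : ℕ) (b : GameBall) : gridBall q b 0 0 = b := by
  ext <;> simp [gridBall]

/-- The grid balls are nested along the parent map `k ↦ k / q`. -/
theorem points_gridBall_succ_subset {q : ℕ} (hq : 0 < q) {b : GameBall} (hb : 0 < b.2) (n k : ℕ) :
    (gridBall q b (n + 1) k).points ⊆ (gridBall q b n (k / q)).points := by
  intro y
  rw [mem_points_gridBall hq, mem_points_gridBall hq]
  rintro ⟨h1, h2⟩
  have hqR : (0 : ℝ) < q := by exact_mod_cast hq
  set u := b.2 / (q : ℝ) ^ (n + 1) with hu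
  have hu0 : 0 < u := by positivity
  have hun : b.2 / (q : ℝ) ^ n = u * q := by
    rw [hu, pow_succ]; field_simp
  rw [hun]
  have hk1 : ((k / q : ℕ) : ℝ) * q ≤ k := by exact_mod_cast Nat.div_mul_le_self k q
  have hk2 : (k : ℝ) + 1 ≤ (((k / q : ℕ) : ℝ) + 1) * q := by
    have := Nat.lt_div_mul_add hq (a := k)
    have h : k + 1 ≤ (k / q + 1) * q := by rw [add_mul, one_mul]; omega
    exact_mod_cast h
  constructor
  · have := mul_le_mul_of_nonneg_left hk1 hu0.le
    nlinarith
  · have := mul_le_mul_of_nonneg_left hk2 hu0.le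
    nlinarith

theorem card_le_of_forall_mem_Icc (s : Finset ℕ) {u w : ℝ} (hw : 0 ≤ w)
    (h : ∀ k ∈ s, u - 1 ≤ k ∧ (k : ℝ) ≤ u + w) : (s.card : ℝ) ≤ w + 2 := by
  rcases s.eq_empty_or_nonempty with rfl | hs
  · simp; linarith
  have hsub : s ⊆ Finset.Icc (s.min' hs) (s.max' hs) := fun k hk =>
    Finset.mem_Icc.2 ⟨s.min'_le k hk, s.le_max' k hk⟩
  have hcard := Finset.card_le_card hsub
  rw [Nat.card_Icc] at hcard
  have h1 := (h _ (s.min'_mem hs)).1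
  have h2 := (h _ (s.max'_mem hs)).2
  have h3 : s.min' hs ≤ s.max' hs := s.min'_le _ (s.max'_mem hs)
  have h4 : s.card + s.min' hs ≤ s.max' hs + 1 := by omega
  have h5 : (s.card : ℝ) + (s.min' hs : ℝ) ≤ (s.max' hs : ℝ) + 1 := by exact_mod_cast h4
  linarith

open Classical in
/-- A ball of radius `a` meets at most `a / r + 2` grid balls of radius `r`. -/
theorem card_filter_meets_gridBall_le {q : ℕ} (hq : 0 < q) {b : GameBall} (hb : 0 < b.2) (n : ℕ)
    (s : Finset ℕ) {p : GameBall} (hp : 0 < p.2) :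
    ((s.filter fun k => (p.points ∩ (gridBall q b n k).points).Nonempty).card : ℝ) ≤
      p.2 / (b.2 / (q : ℝ) ^ n) + 2 := by
  set r := b.2 / (q : ℝ) ^ n with hr
  have hr0 : 0 < r := by positivity
  apply card_le_of_forall_mem_Icc _ (u := (p.1 - p.2 - (b.1 - b.2)) / (2 * r)) (by positivity)
  intro k hk
  obtain ⟨-, y, hy1, hy2⟩ := Finset.mem_filter.1 hk
  rw [mem_points_gridBall hq, ← hr] at hy2
  rw [GameBall.points, Real.closedBall_eq_Icc, mem_Icc] at hy1
  constructor
  · rw [sub_le_iff_le_add, div_le_iff₀ (by positivity)]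
    linarith [hy2.2]
  · rw [show p.2 / r = 2 * p.2 / (2 * r) by field_simp, ← add_div, le_div_iff₀ (by positivity)]
    linarith [hy2.1]

/-! ### Truncated weights -/

/-- The balls of `T` that meet the grid ball `(n, k)`. -/
def ballsMeeting (q : ℕ) (b : GameBall) (n k : ℕ) (T : Set GameBall) : Set GameBall :=
  {p ∈ T | (p.points ∩ (gridBall q b n k).points).Nonempty}

/-- The `c`-weight of a ball relative to the threshold `t`, truncated at `1`. -/
noncomputable def truncWeight (c t : ℝ) (p : GameBall) : ℝ≥0∞ :=
  ENNReal.ofReal (min 1 (p.2 ^ c / t))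

/-- A ball of radius `a` meets at most `a / r + 2` cells. Truncation at `1` controls the `a / r`
cells it may fill, and the untruncated ratio `a ^ c / t` controls the other two. Both terms become
multiples of `a ^ c`, hence summable over the collection. -/
theorem sum_truncWeight_ballsMeeting_le {q : ℕ} (hq : 0 < q) {b : GameBall} (hb : 0 < b.2)
    {c t δ : ℝ} (hc0 : 0 < c) (hc1 : c < 1) (ht : 0 < t) (hδ : 0 < δ) (n : ℕ) (s : Finset ℕ)
    {T : Set GameBall} (hT : ∀ p ∈ T, 0 < p.2)
    (hW : ∑' p : T, ENNReal.ofReal ((p : GameBall).2 ^ c) ≤ ENNReal.ofReal (δ ^ c)) :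
    ∑ k ∈ s, ∑' p : ballsMeeting q b n k T, truncWeight c t p ≤
      ENNReal.ofReal (δ / (b.2 / (q : ℝ) ^ n) + 2 * (δ ^ c / t)) := by
  classical
  set r := b.2 / (q : ℝ) ^ n with hr
  have hr0 : 0 < r := by positivity
  set C := δ ^ (1 - c) / r + 2 / t with hC
  have hC0 : 0 ≤ C := by positivity
  have hswap : ∑ k ∈ s, ∑' p : ballsMeeting q b n k T, truncWeight c t p =
      ∑' p : T, ∑ k ∈ s,
        if ((p : GameBall).points ∩ (gridBall q b n k).points).Nonempty
          then truncWeight c t p else 0 := by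
    rw [Summable.tsum_finsetSum (fun _ _ => ENNReal.summable)]
    refine Finset.sum_congr rfl fun k _ => ?_
    rw [tsum_subtype (ballsMeeting q b n k T) (truncWeight c t),
      tsum_subtype T (fun p : GameBall => if (p.points ∩ (gridBall q b n k).points).Nonempty
          then truncWeight c t p else 0)]
    refine tsum_congr fun p => ?_
    by_cases h1 : p ∈ T <;>
      by_cases h2 : (p.points ∩ (gridBall q b n k).points).Nonempty <;>
      simp [ballsMeeting, indicator, h1, h2]
  have hpt : ∀ p : T, (∑ k ∈ s,
      if ((p : GameBall).points ∩ (gridBall q b n k).points).Nonempty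
        then truncWeight c t p else 0) ≤
      ENNReal.ofReal C * ENNReal.ofReal ((p : GameBall).2 ^ c) := by
    rintro ⟨p, hpT⟩
    have hp := hT p hpT
    -- One ball weighs no more than the whole collection; `a ≤ δ` then gives `a ≤ a ^ c * δ ^ (1 -
    -- c)`, trading length for weight.
    have hpδ : p.2 ≤ δ := by
      have h1 := (ENNReal.le_tsum (f := fun p : T => ENNReal.ofReal ((p : GameBall).2 ^ c))
        ⟨p, hpT⟩).trans hW
      rw [ENNReal.ofReal_le_ofReal_iff (by positivity)] at h1
      exact (Real.rpow_le_rpow_iff hp.le hδ.le hc0).1 h1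
    have hpc : p.2 ≤ p.2 ^ c * δ ^ (1 - c) := by
      calc p.2 = p.2 ^ c * p.2 ^ (1 - c) := by
            rw [← Real.rpow_add hp]; simp
        _ ≤ _ := by gcongr
    have hcard := card_filter_meets_gridBall_le hq hb n s hp
    rw [← hr] at hcard
    dsimp only
    rw [← Finset.sum_filter, Finset.sum_const, nsmul_eq_mul, truncWeight, ← ENNReal.ofReal_natCast,
      ← ENNReal.ofReal_mul (by positivity), ← ENNReal.ofReal_mul hC0]
    apply ENNReal.ofReal_le_ofReal
    have hm0 : 0 ≤ min 1 (p.2 ^ c / t) := by positivity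
    calc _ ≤ (p.2 / r + 2) * min 1 (p.2 ^ c / t) := mul_le_mul_of_nonneg_right hcard hm0
      _ = p.2 / r * min 1 (p.2 ^ c / t) + 2 * min 1 (p.2 ^ c / t) := by ring
      _ ≤ p.2 / r * 1 + 2 * (p.2 ^ c / t) := by
          gcongr
          · exact min_le_left _ _
          · exact min_le_right _ _
      _ ≤ p.2 ^ c * δ ^ (1 - c) / r * 1 + 2 * (p.2 ^ c / t) := by gcongr
      _ = C * p.2 ^ c := by rw [hC]; ring
  calc _ ≤ ∑' p : T, ENNReal.ofReal C * ENNReal.ofReal ((p : GameBall).2 ^ c) := by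
        rw [hswap]; exact ENNReal.tsum_le_tsum hpt
    _ ≤ ENNReal.ofReal C * ENNReal.ofReal (δ ^ c) := by
        rw [ENNReal.tsum_mul_left]; gcongr
    _ = _ := by
        rw [← ENNReal.ofReal_mul hC0]
        congr 1
        have : δ ^ (1 - c) * δ ^ c = δ := by rw [← Real.rpow_add hδ]; simp
        calc C * δ ^ c = δ ^ (1 - c) * δ ^ c / r + 2 * (δ ^ c / t) := by rw [hC]; ring
          _ = _ := by rw [this]

/-- Either one ball reaches the threshold alone, or no weight is truncated. Hence the number of bad
cells is at most the sum of their truncated weights. -/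
theorem one_le_tsum_truncWeight {c t : ℝ} (ht : 0 < t) {T : Set GameBall}
    (hW : ENNReal.ofReal t < ∑' p : T, ENNReal.ofReal ((p : GameBall).2 ^ c)) :
    1 ≤ ∑' p : T, truncWeight c t p := by
  by_cases h : ∃ p ∈ T, t ≤ p.2 ^ c
  · obtain ⟨p, hp, htp⟩ := h
    refine le_trans ?_ (ENNReal.le_tsum (f := fun p : T => truncWeight c t p) ⟨p, hp⟩)
    have : min 1 (p.2 ^ c / t) = 1 := min_eq_left (by rwa [one_le_div ht])
    simp [truncWeight, this]
  · push Not at h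
    have heq : ∀ p : T, truncWeight c t p =
        ENNReal.ofReal ((p : GameBall).2 ^ c) * (ENNReal.ofReal t)⁻¹ := by
      rintro ⟨p, hp⟩
      have : min 1 (p.2 ^ c / t) = p.2 ^ c / t := min_eq_right (by
        rw [div_le_one ht]; exact (h p hp).le)
      rw [truncWeight, this, ENNReal.ofReal_div_of_pos ht, div_eq_mul_inv]
    rw [tsum_congr heq, ENNReal.tsum_mul_right, ← div_eq_mul_inv,
      ENNReal.le_div_iff_mul_le (Or.inl (by simpa using ht)) (Or.inl (by simp)), one_mul]
    exact hW.le

theorem points_gridBall_add_subset {q : ℕ} (hq : 0 < q) {b : GameBall} (hb : 0 < b.2) (n N k : ℕ) :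
    (gridBall q b (n + N) k).points ⊆ (gridBall q b n (k / q ^ N)).points := by
  induction N generalizing k with
  | zero => simp
  | succ N ih =>
    refine (points_gridBall_succ_subset hq hb (n + N) k).trans ?_
    have := ih (k / q)
    rwa [Nat.div_div_eq_div_mul, ← pow_succ'] at this

/-! ### Counting nodes of large potential -/

/-- The total `c`-weight of a collection of balls. -/
noncomputable def totalWeight (c : ℝ) (T : Set GameBall) : ℝ≥0∞ :=
  ∑' p : T, ENNReal.ofReal ((p : GameBall).2 ^ c)

/-- The balls erased at the strict ancestors of the node `(n, k)` that still meet its grid ball,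
where `A j i` is the collection erased at the node `(j, i)`. -/
def erasedHistory (q : ℕ) (b : GameBall) (A : ℕ → ℕ → Set GameBall) (n k : ℕ) : Set GameBall :=
  ballsMeeting q b n k (⋃ j ∈ Finset.range n, A j (k / q ^ (n - j)))

/-- A ball erased before level `n` that meets a cell also meets the larger cell of its ancestor at
level `n`, so it is already charged there. -/
theorem erasedHistory_add_subset {q : ℕ} (hq : 0 < q) {b : GameBall} (hb : 0 < b.2)
    (A : ℕ → ℕ → Set GameBall) (n N k : ℕ) :
    erasedHistory q b A (n + N) k ⊆
      ballsMeeting q b (n + N) k (erasedHistory q b A n (k / q ^ N)) ∪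
        ⋃ j ∈ Finset.range N, ballsMeeting q b (n + N) k (A (n + j) (k / q ^ (N - j))) := by
  rintro p ⟨hp, hmeet⟩
  simp only [mem_iUnion, Finset.mem_range, exists_prop] at hp
  obtain ⟨j, hj, hpj⟩ := hp
  rcases lt_or_ge j n with hjn | hjn
  · left
    refine ⟨⟨?_, hmeet.mono (inter_subset_inter_right _ (points_gridBall_add_subset hq hb n N k))⟩,
      hmeet⟩
    simp only [mem_iUnion, Finset.mem_range, exists_prop]
    refine ⟨j, hjn, ?_⟩
    rwa [Nat.div_div_eq_div_mul, ← pow_add, show N + (n - j) = n + N - j by omega]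
  · right
    simp only [mem_iUnion, Finset.mem_range, exists_prop]
    refine ⟨j - n, by omega, ?_, hmeet⟩
    rwa [show n + (j - n) = j by omega, show N - (j - n) = n + N - j by omega]

theorem scaled_radius_div {q : ℕ} (hq : 0 < q) {r : ℝ} (hr : 0 < r) (α : ℝ) {n m : ℕ}
    (h : n ≤ m) : α * (r / (q : ℝ) ^ n) / (r / (q : ℝ) ^ m) = α * (q : ℝ) ^ (m - n) := by
  have hq' : (0 : ℝ) < q := by exact_mod_cast hq
  obtain ⟨d, rfl⟩ := Nat.exists_eq_add_of_le h
  rw [Nat.add_sub_cancel_left, pow_add]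
  field_simp

open Classical in
/-- The number of descendants, `N` generations later, of a node of small potential, whose potential
is not small. -/
theorem card_large_potential_le {q : ℕ} (hq : 0 < q) {b : GameBall} (hb : 0 < b.2)
    {α c γ : ℝ} (hα : 0 < α) (hγ : 0 < γ) (hc0 : 0 < c) (hc1 : c < 1)
    {A : ℕ → ℕ → Set GameBall}
    (hApos : ∀ n k, k < q ^ n → ∀ p ∈ A n k, 0 < p.2)
    (hA : ∀ n k, k < q ^ n →
      totalWeight c (A n k) ≤ ENNReal.ofReal ((α * (b.2 / (q : ℝ) ^ n)) ^ c))
    (n N k : ℕ) (hk : k < q ^ n)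
    (hgood : totalWeight c (erasedHistory q b A n k) ≤
      ENNReal.ofReal ((γ * (b.2 / (q : ℝ) ^ n)) ^ c)) :
    (((Finset.Ico (k * q ^ N) ((k + 1) * q ^ N)).filter fun k' =>
      ¬ totalWeight c (erasedHistory q b A (n + N) k') ≤
        ENNReal.ofReal ((γ * (b.2 / (q : ℝ) ^ (n + N))) ^ c)).card : ℝ) ≤
      γ * (q : ℝ) ^ N + 2 * ((q : ℝ) ^ N) ^ c +
        ∑ j ∈ Finset.range N, (q : ℝ) ^ j *
          (α * (q : ℝ) ^ (N - j) + 2 * (α / γ * (q : ℝ) ^ (N - j)) ^ c) := by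
  have hqR : (0 : ℝ) < q := by exact_mod_cast hq
  have hqN : 0 < q ^ N := by positivity
  set r' := b.2 / (q : ℝ) ^ (n + N) with hr'
  have hr'0 : 0 < r' := by positivity
  set t := (γ * r') ^ c with ht
  have ht0 : 0 < t := by positivity
  set s := Finset.Ico (k * q ^ N) ((k + 1) * q ^ N) with hs
  set bad := s.filter fun k' => ¬ totalWeight c (erasedHistory q b A (n + N) k') ≤
        ENNReal.ofReal t with hbad
  have hdiv : ∀ k' ∈ s, k' / q ^ N = k := by
    intro k' hk'
    rw [hs, Finset.mem_Ico] at hk'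
    exact Nat.div_eq_of_lt_le hk'.1 hk'.2
  have hpos : ∀ p ∈ erasedHistory q b A n k, 0 < p.2 := by
    rintro p ⟨hp, -⟩
    simp only [mem_iUnion, Finset.mem_range, exists_prop] at hp
    obtain ⟨j, hj, hpj⟩ := hp
    refine hApos _ _ ?_ p hpj
    rw [Nat.div_lt_iff_lt_mul (by positivity), ← pow_add, show j + (n - j) = n by omega]
    exact hk
  have hratio : ∀ (a : ℝ), 0 < a → ∀ j, j ≤ n + N →
      ENNReal.ofReal (a * (b.2 / (q : ℝ) ^ j) / r' + 2 * ((a * (b.2 / (q : ℝ) ^ j)) ^ c / t)) =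
      ENNReal.ofReal (a * (q : ℝ) ^ (n + N - j) + 2 * (a / γ * (q : ℝ) ^ (n + N - j)) ^ c) := by
    intro a ha j hj
    rw [ht, ← Real.div_rpow (by positivity) (by positivity), hr',
      scaled_radius_div hq hb a hj, ← scaled_radius_div hq hb (a / γ) hj]
    congr 4
    field_simp
  have hold : ∑ k' ∈ bad, ∑' p : ballsMeeting q b (n + N) k' (erasedHistory q b A n k),
      truncWeight c t p ≤ ENNReal.ofReal (γ * (q : ℝ) ^ N + 2 * ((q : ℝ) ^ N) ^ c) := by
    refine (sum_truncWeight_ballsMeeting_le hq hb hc0 hc1 ht0 (δ := γ * (b.2 / (q : ℝ) ^ n))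
      (by positivity) (n + N) bad hpos hgood).trans_eq ?_
    rw [← hr', hratio γ hγ n (by omega), div_self hγ.ne', one_mul, Nat.add_sub_cancel_left]
  have hnew : ∀ j ∈ Finset.range N,
      ∑ k' ∈ bad, ∑' p : ballsMeeting q b (n + N) k' (A (n + j) (k' / q ^ (N - j))),
        truncWeight c t p ≤ ENNReal.ofReal ((q : ℝ) ^ j *
          (α * (q : ℝ) ^ (N - j) + 2 * (α / γ * (q : ℝ) ^ (N - j)) ^ c)) := by
    intro j hj
    rw [Finset.mem_range] at hj
    have hpow : q ^ N = q ^ j * q ^ (N - j) := by rw [← pow_add]; congr 1; omega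
    have hmaps : ∀ k' ∈ bad, k' / q ^ (N - j) ∈ Finset.Ico (k * q ^ j) ((k + 1) * q ^ j) := by
      intro k' hk'
      have h1 := (Finset.mem_filter.1 hk').1
      rw [hs, Finset.mem_Ico, hpow, ← mul_assoc, ← mul_assoc] at h1
      have h0 : 0 < q ^ (N - j) := by positivity
      rw [Finset.mem_Ico, Nat.le_div_iff_mul_le h0, Nat.div_lt_iff_lt_mul h0]
      exact h1
    -- The collection erased at level `n + j` depends only on the ancestor at that level. Grouping
    -- by it gives `q ^ j` applications of the weight bound.
    rw [← Finset.sum_fiberwise_of_maps_to hmaps]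
    have hfib : ∀ i ∈ Finset.Ico (k * q ^ j) ((k + 1) * q ^ j),
        ∑ k' ∈ bad with k' / q ^ (N - j) = i,
          ∑' p : ballsMeeting q b (n + N) k' (A (n + j) (k' / q ^ (N - j))), truncWeight c t p ≤
        ENNReal.ofReal (α * (q : ℝ) ^ (N - j) + 2 * (α / γ * (q : ℝ) ^ (N - j)) ^ c) := by
      intro i hi
      have hi' : i < q ^ (n + j) := by
        rw [Finset.mem_Ico] at hi
        calc i < (k + 1) * q ^ j := hi.2
          _ ≤ q ^ n * q ^ j := Nat.mul_le_mul_right _ hk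
          _ = q ^ (n + j) := (pow_add _ _ _).symm
      have h := sum_truncWeight_ballsMeeting_le hq hb hc0 hc1 ht0
        (δ := α * (b.2 / (q : ℝ) ^ (n + j))) (by positivity) (n + N)
        (bad.filter fun k' => k' / q ^ (N - j) = i) (hApos _ _ hi') (hA _ _ hi')
      rw [← hr', hratio α hα (n + j) (by omega), show n + N - (n + j) = N - j by omega] at h
      refine le_trans (le_of_eq ?_) h
      refine Finset.sum_congr rfl fun k' hk' => ?_
      rw [(Finset.mem_filter.1 hk').2]
    refine (Finset.sum_le_sum hfib).trans_eq ?_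
    rw [Finset.sum_const, Nat.card_Ico, ← Nat.sub_mul, Nat.add_sub_cancel_left, one_mul,
      nsmul_eq_mul, ENNReal.ofReal_mul (by positivity), ENNReal.ofReal_pow (by positivity),
      ENNReal.ofReal_natCast, Nat.cast_pow]
  have hmain : (bad.card : ℝ≥0∞) ≤ ENNReal.ofReal (γ * (q : ℝ) ^ N + 2 * ((q : ℝ) ^ N) ^ c +
        ∑ j ∈ Finset.range N, (q : ℝ) ^ j *
          (α * (q : ℝ) ^ (N - j) + 2 * (α / γ * (q : ℝ) ^ (N - j)) ^ c)) := by
    have hone : ∀ k' ∈ bad, 1 ≤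
        (∑' p : ballsMeeting q b (n + N) k' (erasedHistory q b A n k), truncWeight c t p) +
        ∑ j ∈ Finset.range N,
          ∑' p : ballsMeeting q b (n + N) k' (A (n + j) (k' / q ^ (N - j))),
            truncWeight c t p := by
      intro k' hk'
      obtain ⟨hk's, hk'b⟩ := Finset.mem_filter.1 hk'
      refine (one_le_tsum_truncWeight ht0 (not_le.1 hk'b)).trans ?_
      refine (ENNReal.tsum_mono_subtype (truncWeight c t)
        (erasedHistory_add_subset hq hb A n N k')).trans ?_
      refine (ENNReal.tsum_union_le _ _ _).trans ?_
      rw [hdiv k' hk's]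
      gcongr
      exact ENNReal.tsum_biUnion_le _ _ _
    calc (bad.card : ℝ≥0∞) = ∑ k' ∈ bad, 1 := by simp
      _ ≤ _ := Finset.sum_le_sum hone
      _ = _ := Finset.sum_add_distrib
      _ ≤ _ := add_le_add hold
          ((Finset.sum_comm.trans_le (Finset.sum_le_sum hnew)))
      _ = _ := by
          rw [← ENNReal.ofReal_sum_of_nonneg (fun _ _ => by positivity),
            ← ENNReal.ofReal_add (by positivity)
              (Finset.sum_nonneg fun _ _ => by positivity)]
  rw [← ENNReal.ofReal_natCast] at hmain
  rwa [ENNReal.ofReal_le_ofReal_iff (add_nonneg (by positivity)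
    (Finset.sum_nonneg fun _ _ => by positivity))] at hmain

/-- The bound of `card_large_potential_le` with `γ = 1 / 8` is at most half the number of
descendants when `N` is about `1 / (8 α)`. -/
theorem large_potential_bound_le_half {q : ℕ} (hq : 2 ≤ q) {α c : ℝ} (hα : 0 < α) (hα1 : α ≤ 1)
    (hc0 : 0 < c) (hc1 : c < 1) {N : ℕ} (hN : N * α ≤ 1 / 8) (hN' : 1 / 16 ≤ N * α)
    (hαc : 720 ^ 2 * α ^ c ≤ 2 * (1 - (q : ℝ) ^ (c - 1))) :
    1 / 8 * (q : ℝ) ^ N + 2 * ((q : ℝ) ^ N) ^ c +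
        ∑ j ∈ Finset.range N, (q : ℝ) ^ j *
          (α * (q : ℝ) ^ (N - j) + 2 * (α / (1 / 8) * (q : ℝ) ^ (N - j)) ^ c) ≤
      (q : ℝ) ^ N / 2 := by
  have hq0 : (0 : ℝ) < q := by positivity
  set t := (q : ℝ) ^ (c - 1) with ht
  have ht0 : 0 < t := by positivity
  have hαa : α ≤ α ^ c := by
    conv_lhs => rw [← Real.rpow_one α]
    exact Real.rpow_le_rpow_of_exponent_ge hα hα1 hc1.le
  have ha0 : 0 < α ^ c := by positivity
  have ht1 : t < 1 := by nlinarith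
  have hpowc : ∀ m : ℕ, ((q : ℝ) ^ m) ^ c = (q : ℝ) ^ m * t ^ m := by
    intro m
    have hqc : (q : ℝ) ^ c = q * t := by
      rw [ht, ← Real.rpow_one_add' hq0.le (by linarith)]; congr 1; ring
    rw [← Real.rpow_natCast, ← Real.rpow_mul hq0.le, mul_comm (m : ℝ) c, Real.rpow_mul hq0.le, hqc,
      Real.rpow_natCast, mul_pow, Real.rpow_natCast]
  have h8 : (8 * α) ^ c ≤ 8 * α ^ c := by
    rw [Real.mul_rpow (by norm_num) hα.le]
    gcongr
    conv_rhs => rw [← Real.rpow_one 8]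
    exact Real.rpow_le_rpow_of_exponent_le (by norm_num) hc1.le
  -- The exponent `N - j` is lowered to `N - 1 - j` so that the sum becomes a reflected geometric
  -- series.
  have hterm : ∀ j ∈ Finset.range N, (q : ℝ) ^ j *
      (α * (q : ℝ) ^ (N - j) + 2 * (α / (1 / 8) * (q : ℝ) ^ (N - j)) ^ c) ≤
      (q : ℝ) ^ N * (α + 16 * α ^ c * t ^ (N - 1 - j)) := by
    intro j hj
    rw [Finset.mem_range] at hj
    have hpow : (q : ℝ) ^ N = q ^ j * q ^ (N - j) := by rw [← pow_add]; congr 1; omega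
    have htp : t ^ (N - j) ≤ t ^ (N - 1 - j) := pow_le_pow_of_le_one ht0.le ht1.le (by omega)
    rw [show α / (1 / 8) = 8 * α by ring, Real.mul_rpow (by positivity) (by positivity), hpowc,
      hpow]
    have h1 : (8 * α) ^ c * t ^ (N - j) ≤ 8 * α ^ c * t ^ (N - 1 - j) := by gcongr
    have h2 : 0 ≤ (q : ℝ) ^ j * q ^ (N - j) := by positivity
    nlinarith [mul_le_mul_of_nonneg_left h1 h2]
  have hgeom : ∑ j ∈ Finset.range N, t ^ (N - 1 - j) ≤ 1 / (1 - t) := by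
    rw [Finset.sum_range_reflect (fun i => t ^ i) N, le_div_iff₀ (by linarith),
      geom_sum_mul_neg]
    linarith [pow_pos ht0 N]
  have hsum := Finset.sum_le_sum hterm
  rw [← Finset.mul_sum, Finset.sum_add_distrib, Finset.sum_const, Finset.card_range, nsmul_eq_mul,
    ← Finset.mul_sum] at hsum
  have hsmall : 16 * α ^ c * ∑ j ∈ Finset.range N, t ^ (N - 1 - j) ≤ 1 / 100 := by
    calc _ ≤ 16 * α ^ c * (1 / (1 - t)) := by gcongr
      _ ≤ 1 / 100 := by
        rw [mul_one_div, div_le_iff₀ (by linarith)]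
        linarith
  -- As `α ≤ α ^ c`, the hypothesis gives `1 - t ≥ (720 ^ 2 / 2) α`; with `N α ≥ 1 / 16` this makes
  -- `N (1 - t)` large, and `t ^ N ≤ exp (-N (1 - t))`.
  have htN : t ^ N ≤ 1 / 100 := by
    have h1 : t ≤ Real.exp (-(1 - t)) := by linarith [Real.add_one_le_exp (-(1 - t))]
    have h2 : t ^ N ≤ Real.exp (-(N * (1 - t))) := by
      calc t ^ N ≤ Real.exp (-(1 - t)) ^ N := by gcongr
        _ = _ := by rw [← Real.exp_nat_mul]; congr 1; ring
    have h3 : (100 : ℝ) ≤ N * (1 - t) := by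
      have : (720 ^ 2 / 2) * α ≤ 1 - t := by linarith
      nlinarith [Nat.cast_nonneg (α := ℝ) N]
    refine h2.trans ?_
    rw [Real.exp_neg, inv_eq_one_div]
    apply one_div_le_one_div_of_le (by norm_num)
    linarith [Real.add_one_le_exp (N * (1 - t))]
  have hQ : (0 : ℝ) < (q : ℝ) ^ N := by positivity
  rw [hpowc N]
  calc _ ≤ 1 / 8 * (q : ℝ) ^ N + 2 * ((q : ℝ) ^ N * (1 / 100)) +
        (q : ℝ) ^ N * (1 / 8 + 1 / 100) := by
        refine add_le_add (by gcongr) (hsum.trans ?_)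
        gcongr
    _ ≤ _ := by linarith

/-! ### Dimension of the limit set of a tree -/

theorem exists_mem_points_gridBall {Q : ℕ} (hQ : 0 < Q) {b : GameBall} (hb : 0 < b.2) {κ : ℕ → ℕ}
    (hκ : ∀ m, κ (m + 1) / Q = κ m) : ∃ x, ∀ m, x ∈ (gridBall Q b m (κ m)).points := by
  have h := IsCompact.nonempty_iInter_of_sequence_nonempty_isCompact_isClosed
    (fun m => (gridBall Q b m (κ m)).points)
    (fun m => by rw [← hκ m]; exact points_gridBall_succ_subset hQ hb m _)
    (fun m => ⟨_, Metric.mem_closedBall_self (by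
      have : (0 : ℝ) < (Q : ℝ) ^ m := by positivity
      simp only [gridBall]; positivity)⟩)
    (isCompact_closedBall _ _) (fun m => Metric.isClosed_closedBall)
  obtain ⟨x, hx⟩ := h
  exact ⟨x, by simpa using hx⟩

/-- Points of two grid balls of the same level whose indices differ by at least `2` are separated. -/
theorem le_sub_of_mem_points_gridBall {Q : ℕ} (hQ : 0 < Q) {b : GameBall} (hb : 0 < b.2)
    {m k k' : ℕ} (h : k + 2 ≤ k') {x y : ℝ} (hx : x ∈ (gridBall Q b m k).points)
    (hy : y ∈ (gridBall Q b m k').points) : 2 * (b.2 / (Q : ℝ) ^ m) ≤ y - x := by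
  rw [mem_points_gridBall hQ] at hx hy
  have hr : (0 : ℝ) < b.2 / (Q : ℝ) ^ m := by positivity
  have h' : (k : ℝ) + 2 ≤ k' := by exact_mod_cast h
  nlinarith [hx.2, hy.1]

theorem le_abs_sub_of_mem_points_gridBall {Q : ℕ} (hQ : 0 < Q) {b : GameBall} (hb : 0 < b.2)
    {m k k' : ℕ} (h : k + 2 ≤ k' ∨ k' + 2 ≤ k) {x y : ℝ} (hx : x ∈ (gridBall Q b m k).points)
    (hy : y ∈ (gridBall Q b m k').points) : 2 * (b.2 / (Q : ℝ) ^ m) ≤ |x - y| := by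
  rcases h with h | h
  · rw [abs_sub_comm]
    exact (le_sub_of_mem_points_gridBall hQ hb h hx hy).trans (le_abs_self _)
  · exact (le_sub_of_mem_points_gridBall hQ hb h hy hx).trans (le_abs_self _)

/-- The limit set of a tree of grid balls: the points lying in all balls of an infinite branch all
of whose nodes satisfy `P`. -/
def treeLimitSet (Q : ℕ) (b : GameBall) (P : ℕ → ℕ → Prop) : Set ℝ :=
  {x | ∃ κ : ℕ → ℕ, κ 0 = 0 ∧ (∀ m, κ (m + 1) / Q = κ m) ∧ (∀ m, P m (κ m)) ∧
    ∀ m, x ∈ (gridBall Q b m (κ m)).points}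

/-- If every node of a tree of grid balls has `M` pairwise nonadjacent children in the tree, then
the limit set has dimension at least `log M / log Q`. -/
theorem le_dimH_treeLimitSet {Q M : ℕ} (hQ : 2 ≤ Q) (hM : 2 ≤ M) {b : GameBall} (hb : 0 < b.2)
    {P : ℕ → ℕ → Prop} (h0 : P 0 0)
    (hstep : ∀ m k, P m k → ∃ e : Fin M → ℕ, (∀ i, e i / Q = k ∧ P (m + 1) (e i)) ∧
      ∀ i i', i ≠ i' → e i + 2 ≤ e i' ∨ e i' + 2 ≤ e i) :
    ENNReal.ofReal (Real.log M / Real.log Q) ≤ dimH (treeLimitSet Q b P) := by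
  classical
  have hQ0 : 0 < Q := by omega
  -- Outside `P` the children are arbitrary; the branches below never leave `P`.
  choose! e he hsep using hstep
  let κ : (ℕ → Fin M) → ℕ → ℕ := fun d m => Nat.rec 0 (fun m k => e m k (d m)) m
  have hκ0 : ∀ d, κ d 0 = 0 := fun d => rfl
  have hκs : ∀ d m, κ d (m + 1) = e m (κ d m) (d m) := fun d m => rfl
  have hP : ∀ d m, P m (κ d m) := by
    intro d m
    induction m with
    | zero => exact h0
    | succ m ih => rw [hκs]; exact (he m _ ih (d m)).2
  have hdiv : ∀ d m, κ d (m + 1) / Q = κ d m := fun d m => by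
    rw [hκs]; exact (he m _ (hP d m) (d m)).1
  choose x hx using fun d => exists_mem_points_gridBall hQ0 hb (hdiv d)
  set s := Real.log M / Real.log Q with hs
  have hMR : (1 : ℝ) < M := by exact_mod_cast hM
  have hQR : (1 : ℝ) < Q := by exact_mod_cast hQ
  have hs0 : 0 < s := div_pos (Real.log_pos hMR) (Real.log_pos hQR)
  have hQs : (Q : ℝ) ^ s = M := by
    rw [Real.rpow_def_of_pos (by linarith), hs, mul_div_cancel₀ _ (Real.log_pos hQR).ne',
      Real.exp_log (by linarith)]
  -- If two digit sequences first differ at place `m`, their base-`M` values differ by at most `M ^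
  -- (-m)`, while the points are `2 b.2 / Q ^ (m + 1)` apart. Since `Q ^ s = M`, the numerator `M`
  -- of `C` absorbs the shift by one level.
  set C := (M : ℝ) / (2 * b.2) ^ s with hC
  have hC0 : 0 ≤ C := by positivity
  have hholder : ∀ d d', |Real.ofDigits d - Real.ofDigits d'| ≤ C * |x d - x d'| ^ s := by
    intro d d'
    by_cases hdd : d = d'
    · subst hdd; simp; positivity
    have hex : ∃ m, d m ≠ d' m := by
      by_contra! h; exact hdd (funext h)
    set m := Nat.find hex with hm
    have hne : d m ≠ d' m := Nat.find_spec hex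
    have heq : ∀ i < m, d i = d' i := fun i hi => by simpa using Nat.find_min hex hi
    have hκeq : ∀ j ≤ m, κ d j = κ d' j := by
      intro j
      induction j with
      | zero => intro _; rfl
      | succ j ih => intro hj; rw [hκs, hκs, ih (by omega), heq j (by omega)]
    have hfar := hsep m _ (hP d m) _ _ hne
    have h2 := hκs d' m
    rw [← hκeq m le_rfl] at h2
    rw [← hκs, ← h2] at hfar
    have hdist := le_abs_sub_of_mem_points_gridBall hQ0 hb hfar (hx d (m + 1)) (hx d' (m + 1))
    have hdig := Real.abs_ofDigits_sub_ofDigits_le heq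
    refine hdig.trans ?_
    have hpow : ((Q : ℝ) ^ (m + 1)) ^ s = (M : ℝ) ^ (m + 1) := by
      rw [← Real.rpow_natCast, ← Real.rpow_mul (by linarith), mul_comm, Real.rpow_mul (by linarith),
        hQs, Real.rpow_natCast]
    calc ((M : ℝ) ^ m)⁻¹ = C * (2 * (b.2 / (Q : ℝ) ^ (m + 1))) ^ s := by
          rw [← mul_div_assoc, Real.div_rpow (by positivity) (by positivity), hpow, hC, pow_succ]
          have : (2 * b.2) ^ s ≠ 0 := by positivity
          field_simp
      _ ≤ _ := by gcongr
  have hinj : ∀ d d', x d = x d' → Real.ofDigits d = Real.ofDigits d' := by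
    intro d d' h
    have := hholder d d'
    rw [h, sub_self, abs_zero, Real.zero_rpow hs0.ne', mul_zero] at this
    exact sub_eq_zero.1 (abs_nonpos_iff.1 this)
  -- Reading off the digits maps the limit points Hölder-continuously onto `[0, 1]`, so their
  -- dimension is at least the exponent `s`. The value `0` elsewhere plays no role.
  let f : ℝ → ℝ := fun y => if h : ∃ d, x d = y then Real.ofDigits h.choose else 0
  have hf : ∀ d, f (x d) = Real.ofDigits d := by
    intro d
    have h : ∃ d', x d' = x d := ⟨d, rfl⟩
    simp only [f, dif_pos h]
    exact hinj _ _ h.choose_spec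
  have hfH : HolderOnWith C.toNNReal s.toNNReal f (range x) := by
    rintro _ ⟨d, rfl⟩ _ ⟨d', rfl⟩
    rw [hf, hf, edist_dist, edist_dist, Real.dist_eq, Real.dist_eq, Real.coe_toNNReal _ hs0.le,
      ENNReal.ofReal_rpow_of_nonneg (abs_nonneg _) hs0.le]
    change _ ≤ ENNReal.ofReal C * _
    rw [← ENNReal.ofReal_mul hC0]
    exact ENNReal.ofReal_le_ofReal (hholder d d')
  have hdim := hfH.dimH_image_le (Real.toNNReal_pos.2 hs0)
  have himg : Icc (0 : ℝ) 1 ⊆ f '' range x := by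
    intro y hy
    obtain ⟨d, -, hd⟩ := Real.ofDigits_SurjOn (b := M) (by omega) hy
    exact ⟨x d, ⟨d, rfl⟩, by rw [hf, hd]⟩
  have hone : (1 : ℝ≥0∞) ≤ dimH (range x) / s.toNNReal := by
    refine le_trans ?_ hdim
    refine le_trans (le_of_eq ?_) (dimH_mono himg)
    rw [Real.dimH_of_nonempty_interior]
    · simp
    · rw [interior_Icc]; exact nonempty_Ioo.2 zero_lt_one
  have hle : (s.toNNReal : ℝ≥0∞) ≤ dimH (range x) := by
    rwa [ENNReal.le_div_iff_mul_le (Or.inl (by simpa using hs0)) (Or.inl (by simp)),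
      one_mul] at hone
  refine le_trans hle (dimH_mono ?_)
  rintro _ ⟨d, rfl⟩
  exact ⟨κ d, hκ0 d, hdiv d, hP d, hx d⟩

/-- Among `2 M` natural numbers there are `M` pairwise nonadjacent ones. -/
theorem exists_nonadjacent_of_two_mul_le_card {G : Finset ℕ} {M : ℕ} (h : 2 * M ≤ G.card) :
    ∃ e : Fin M → ℕ, (∀ i, e i ∈ G) ∧ ∀ i i', i ≠ i' → e i + 2 ≤ e i' ∨ e i' + 2 ≤ e i := by
  have hsplit := Finset.card_filter_add_card_filter_not (s := G) (fun k => k % 2 = 0)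
  have key : ∀ F ⊆ G, (∀ k ∈ F, ∀ k' ∈ F, k % 2 = k' % 2) → M ≤ F.card →
      ∃ e : Fin M → ℕ, (∀ i, e i ∈ G) ∧
        ∀ i i', i ≠ i' → e i + 2 ≤ e i' ∨ e i' + 2 ≤ e i := by
    intro F hFG hpar hcard
    obtain ⟨F', hF'F, hF'⟩ := Finset.exists_subset_card_eq hcard
    refine ⟨F'.orderEmbOfFin hF', fun i => hFG (hF'F (F'.orderEmbOfFin_mem hF' i)), ?_⟩
    intro i i' hii
    have h1 : F'.orderEmbOfFin hF' i ≠ F'.orderEmbOfFin hF' i' := by simpa using hii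
    have h2 := hpar _ (hF'F (F'.orderEmbOfFin_mem hF' i)) _ (hF'F (F'.orderEmbOfFin_mem hF' i'))
    omega
  rcases le_total M (G.filter fun k => k % 2 = 0).card with hM | hM
  · refine key _ (Finset.filter_subset _ _) ?_ hM
    intro k hk k' hk'
    rw [Finset.mem_filter] at hk hk'
    omega
  · refine key (G.filter fun k => ¬ k % 2 = 0) (Finset.filter_subset _ _) ?_ (by omega)
    intro k hk k' hk'
    rw [Finset.mem_filter] at hk hk'
    omega

/-! ### Playing the game along the grid -/

theorem branch_div_pow {q : ℕ} {κ : ℕ → ℕ} (hκ : ∀ m, κ (m + 1) / q = κ m) (m i : ℕ) :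
    κ (m + i) / q ^ i = κ m := by
  induction i with
  | zero => simp
  | succ i ih => rw [pow_succ', ← Nat.div_div_eq_div_mul, ← add_assoc, hκ, ih]

theorem isLegalBobPlay_gridBall {q : ℕ} (hq : 2 ≤ q) {β ρ : ℝ} {b : GameBall} (hb : 0 < b.2)
    (hρ : ρ ≤ b.2) (hβ : β * q ≤ 1) {κ : ℕ → ℕ} (hκ : ∀ m, κ (m + 1) / q = κ m) :
    IsLegalBobPlay β ρ (fun m => gridBall q b m (κ m)) := by
  have hqR : (0 : ℝ) < q := by positivity
  refine ⟨fun m => by simp only [gridBall]; positivity, by simpa [gridBall] using hρ, fun m => ?_,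
    fun m => ?_, ?_⟩
  · have h : 0 < b.2 / (q : ℝ) ^ (m + 1) := by positivity
    simp only [gridBall]
    calc β * (b.2 / (q : ℝ) ^ m) = β * q * (b.2 / (q : ℝ) ^ (m + 1)) := by
          rw [pow_succ]; field_simp
      _ ≤ 1 * (b.2 / (q : ℝ) ^ (m + 1)) := by gcongr
      _ = _ := one_mul _
  · have := points_gridBall_succ_subset (by omega : 0 < q) hb m (κ (m + 1))
    rwa [hκ m] at this
  · simp only [gridBall]
    exact tendsto_const_nhds.div_atTop
      (tendsto_pow_atTop_atTop_of_one_lt (by exact_mod_cast hq))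

/-- Alice's answer at the node `(n, k)` of the grid of `b`. -/
def AliceStrategy.gridAnswer (σ : AliceStrategy) (q : ℕ) (b : GameBall) (n k : ℕ) :
    Set GameBall :=
  σ ((List.range (n + 1)).map fun j => gridBall q b j (k / q ^ (n - j)))

/-- A node determines all its ancestors, hence Bob's whole history. This turns the strategy into a
family of collections indexed by nodes. -/
theorem AliceStrategy.answer_gridBall (σ : AliceStrategy) {q : ℕ} (b : GameBall) {κ : ℕ → ℕ}
    (hκ : ∀ m, κ (m + 1) / q = κ m) (n : ℕ) :
    σ.answer (fun m => gridBall q b m (κ m)) n = σ.gridAnswer q b n (κ n) := by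
  rw [AliceStrategy.answer, AliceStrategy.gridAnswer]
  congr 1
  refine List.map_congr_left fun j hj => ?_
  rw [List.mem_range] at hj
  have := branch_div_pow hκ j (n - j)
  rw [show j + (n - j) = n by omega] at this
  rw [this]

/-- Every node of the grid lies on an infinite branch. -/
theorem exists_branch {q : ℕ} (hq : 0 < q) {n k : ℕ} :
    ∃ κ : ℕ → ℕ, (∀ m, κ (m + 1) / q = κ m) ∧ κ n = k := by
  -- Ancestors of `k` up to level `n`, then always the leftmost child.
  refine ⟨fun j => k * q ^ j / q ^ n, fun m => ?_, Nat.mul_div_cancel _ (by positivity)⟩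
  dsimp only
  rw [Nat.div_div_eq_div_mul, pow_succ, ← mul_assoc, Nat.mul_div_mul_right _ _ hq]

/-- The tree of the nodes, every `N` generations, at which the erased balls met so far have small
total weight. -/
def smallPotential (q N : ℕ) (b : GameBall) (c γ : ℝ) (A : ℕ → ℕ → Set GameBall) (m k : ℕ) :
    Prop :=
  k < q ^ (N * m) ∧ totalWeight c (erasedHistory q b A (N * m) k) ≤
    ENNReal.ofReal ((γ * (b.2 / (q : ℝ) ^ (N * m))) ^ c)

theorem smallPotential_zero (q N : ℕ) (b : GameBall) (c γ : ℝ) (A : ℕ → ℕ → Set GameBall) :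
    smallPotential q N b c γ A 0 0 := by
  have : erasedHistory q b A 0 0 = ∅ := by ext; simp [erasedHistory, ballsMeeting]
  simp [smallPotential, this, totalWeight]

/-- At least half of the `q ^ N` descendants are good; discarding one parity costs another factor of
two. -/
theorem exists_children_smallPotential {q : ℕ} (hq : 0 < q) {b : GameBall} (hb : 0 < b.2)
    {α c γ : ℝ} (hα : 0 < α) (hγ : 0 < γ) (hc0 : 0 < c) (hc1 : c < 1)
    {A : ℕ → ℕ → Set GameBall}
    (hApos : ∀ n k, k < q ^ n → ∀ p ∈ A n k, 0 < p.2)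
    (hA : ∀ n k, k < q ^ n →
      totalWeight c (A n k) ≤ ENNReal.ofReal ((α * (b.2 / (q : ℝ) ^ n)) ^ c))
    {N : ℕ} (hbound : γ * (q : ℝ) ^ N + 2 * ((q : ℝ) ^ N) ^ c +
        ∑ j ∈ Finset.range N, (q : ℝ) ^ j *
          (α * (q : ℝ) ^ (N - j) + 2 * (α / γ * (q : ℝ) ^ (N - j)) ^ c) ≤ (q : ℝ) ^ N / 2)
    (m k : ℕ) (hk : smallPotential q N b c γ A m k) :
    ∃ e : Fin (q ^ N / 4) → ℕ,
      (∀ i, e i / q ^ N = k ∧ smallPotential q N b c γ A (m + 1) (e i)) ∧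
      ∀ i i', i ≠ i' → e i + 2 ≤ e i' ∨ e i' + 2 ≤ e i := by
  classical
  have hcard := (card_large_potential_le hq hb hα hγ hc0 hc1 hApos hA (N * m) N k hk.1 hk.2).trans
    hbound
  set s := Finset.Ico (k * q ^ N) ((k + 1) * q ^ N) with hs
  have hsplit := Finset.card_filter_add_card_filter_not (s := s) (fun k' =>
    totalWeight c (erasedHistory q b A (N * m + N) k') ≤
        ENNReal.ofReal ((γ * (b.2 / (q : ℝ) ^ (N * m + N))) ^ c))
  have hscard : s.card = q ^ N := by
    rw [hs, Nat.card_Ico, ← Nat.sub_mul, Nat.add_sub_cancel_left, one_mul]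
  have hhalf : ∀ a : ℕ, (a : ℝ) ≤ (q : ℝ) ^ N / 2 → a * 2 ≤ q ^ N := fun a ha => by
    rw [le_div_iff₀ two_pos] at ha
    exact_mod_cast ha
  replace hcard := hhalf _ hcard
  rw [hscard] at hsplit
  obtain ⟨e, he, hsep⟩ := exists_nonadjacent_of_two_mul_le_card (M := q ^ N / 4) (G := s.filter
    fun k' => totalWeight c (erasedHistory q b A (N * m + N) k') ≤
        ENNReal.ofReal ((γ * (b.2 / (q : ℝ) ^ (N * m + N))) ^ c)) (by omega)
  refine ⟨e, fun i => ?_, hsep⟩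
  obtain ⟨h1, h2⟩ := Finset.mem_filter.1 (he i)
  rw [hs, Finset.mem_Ico] at h1
  refine ⟨Nat.div_eq_of_lt_le h1.1 h1.2, ?_, h2⟩
  calc e i < (k + 1) * q ^ N := h1.2
    _ ≤ q ^ (N * m) * q ^ N := Nat.mul_le_mul_right _ hk.1
    _ = q ^ (N * (m + 1)) := by rw [← pow_add, mul_add, mul_one]

/-- A point all of whose grid balls have small potential is never erased. -/
theorem treeLimitSet_smallPotential_subset {q : ℕ} (hq : 2 ≤ q) {N : ℕ} (hN : 1 ≤ N)
    {α β c ρ γ : ℝ} {S : Set ℝ} {b : GameBall} (hb : 0 < b.2) (hρ : ρ ≤ b.2) (hβ : β * q ≤ 1)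
    (hc0 : 0 < c) (hγ : 0 < γ) {σ : AliceStrategy}
    (hσ : ∀ B : ℕ → GameBall, IsLegalBobPlay β ρ B →
      (∀ m, IsLegalErasure α c (B m).2 (σ.answer B m)) ∧
      ∀ x : ℝ, (∀ m, x ∈ (B m).points) →
        x ∉ ⋃ m, ⋃ p ∈ σ.answer B m, p.points → x ∈ S) :
    treeLimitSet (q ^ N) b (smallPotential q N b c γ (σ.gridAnswer q b)) ⊆ S ∩ b.points := by
  rintro x ⟨κ', h0, hdiv', hsmall, hx'⟩
  have hq0 : 0 < q := by omega
  have hgrid : ∀ m k, gridBall (q ^ N) b m k = gridBall q b (N * m) k := fun m k => by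
    simp only [gridBall, pow_mul, Nat.cast_pow]
  -- The given branch visits only levels `N m`. At level `j` take the ancestor of its node at level
  -- `N j ≥ j`, which fills in all of Bob's turns.
  set κ : ℕ → ℕ := fun j => κ' j / q ^ (N * j - j) with hκdef
  have hNj : ∀ j, j ≤ N * j := fun j => Nat.le_mul_of_pos_left j hN
  have hκ : ∀ j, κ (j + 1) / q = κ j := by
    intro j
    have h1 := hNj j
    simp only [hκdef]
    rw [Nat.div_div_eq_div_mul, ← pow_succ, ← hdiv' j, Nat.div_div_eq_div_mul, ← pow_add]
    congr 2
    rw [mul_add]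
    omega
  have hκN : ∀ m, κ (N * m) = κ' m := by
    intro m
    have h1 := hNj m
    have h2 := branch_div_pow hdiv' m (N * m - m)
    rw [show m + (N * m - m) = N * m by omega, ← pow_mul] at h2
    rw [← h2]
    simp only [hκdef]
    congr 2
    rw [Nat.mul_sub]
  have hx : ∀ j, x ∈ (gridBall q b j (κ j)).points := by
    intro j
    have h1 := hx' j
    rw [hgrid] at h1
    have h2 := points_gridBall_add_subset hq0 hb j (N * j - j) (κ' j)
    rw [show j + (N * j - j) = N * j by have := hNj j; omega] at h2
    exact h2 h1
  have hplay := isLegalBobPlay_gridBall hq hb hρ hβ hκ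
  obtain ⟨hlegal, hout⟩ := hσ _ hplay
  refine ⟨hout x hx ?_, ?_⟩
  · intro hmem
    simp only [mem_iUnion, exists_prop] at hmem
    obtain ⟨j, p, hp, hxp⟩ := hmem
    have hp0 : 0 < p.2 := (hlegal j).2.1 p hp
    rw [σ.answer_gridBall b hκ] at hp
    -- The ball contains `x`, so it meets every later cell of the branch and counts in every later
    -- potential.
    have hle : ∀ m, j + 1 ≤ m → p.2 ≤ γ * (b.2 / (q : ℝ) ^ (N * m)) := by
      intro m hm
      have hjm : j < N * m := by have := hNj m; omega
      have hpH : p ∈ erasedHistory q b (σ.gridAnswer q b) (N * m) (κ' m) := by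
        refine ⟨?_, x, hxp, by rw [← hgrid]; exact hx' m⟩
        simp only [mem_iUnion, Finset.mem_range, exists_prop]
        refine ⟨j, hjm, ?_⟩
        have := branch_div_pow hκ j (N * m - j)
        rw [show j + (N * m - j) = N * m by omega, hκN] at this
        rwa [this]
      have h1 := (ENNReal.le_tsum (f := fun p : erasedHistory q b (σ.gridAnswer q b) (N * m) (κ' m)
        => ENNReal.ofReal ((p : GameBall).2 ^ c)) ⟨p, hpH⟩).trans (hsmall m).2
      rw [ENNReal.ofReal_le_ofReal_iff (by positivity)] at h1
      exact (Real.rpow_le_rpow_iff hp0.le (by positivity) hc0).1 h1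
    have hlim : Tendsto (fun m : ℕ => γ * (b.2 / (q : ℝ) ^ (N * m))) atTop (𝓝 0) := by
      have h1 : Tendsto (fun m : ℕ => (q : ℝ) ^ (N * m)) atTop atTop :=
        (tendsto_pow_atTop_atTop_of_one_lt (by exact_mod_cast hq)).comp
          (tendsto_id.const_mul_atTop' hN)
      simpa using (tendsto_const_nhds (x := b.2).div_atTop h1).const_mul γ
    have := ge_of_tendsto hlim (eventually_atTop.2 ⟨j + 1, hle⟩)
    linarith
  · have h1 := hx' 0
    rwa [h0, gridBall_zero] at h1

/-! ### Choice of parameters and conclusion -/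

/-- The two endpoints have dimension zero, so the open case reduces to the closed one. -/
theorem dimH_inter_closedBall_le (S : Set ℝ) (x r : ℝ) :
    dimH (S ∩ Metric.closedBall x r) ≤ dimH (S ∩ Metric.ball x r) := by
  have hsub : S ∩ Metric.closedBall x r ⊆ (S ∩ Metric.ball x r) ∪ {x - r, x + r} := by
    rintro y ⟨hyS, hy⟩
    rw [Real.closedBall_eq_Icc, mem_Icc] at hy
    rw [Real.ball_eq_Ioo]
    by_cases h1 : y = x - r
    · simp [h1]
    by_cases h2 : y = x + r
    · simp [h2]
    exact Or.inl ⟨hyS, lt_of_le_of_ne hy.1 (Ne.symm h1), lt_of_le_of_ne hy.2 h2⟩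
  refine (dimH_mono hsub).trans ?_
  rw [dimH_union, dimH_finite (s := {x - r, x + r}) (toFinite _)]
  simp

theorem le_dimH_of_isPotentialWinning {α β c ρ : ℝ} {S : Set ℝ} {b : GameBall} (hb : 0 < b.2)
    (hρ : ρ ≤ b.2) (hα : 0 < α) (hc0 : 0 < c) (hc1 : c < 1)
    (hS : IsPotentialWinning α β c ρ S) {q N : ℕ} (hq : 4 ≤ q) (hβ : β * q ≤ 1)
    (hN2 : 2 ≤ N) (hα1 : α ≤ 1) (hN : N * α ≤ 1 / 8) (hN' : 1 / 16 ≤ N * α)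
    (hαc : 720 ^ 2 * α ^ c ≤ 2 * (1 - (q : ℝ) ^ (c - 1))) :
    ENNReal.ofReal (1 - Real.log 6 / (N * Real.log q)) ≤ dimH (S ∩ b.points) := by
  obtain ⟨σ, hσ⟩ := hS
  have hq0 : 0 < q := by omega
  -- For `k ≥ q ^ n` the branch starts from a translate of `b`, which is still a legal first move.
  have hlegal : ∀ n k, IsLegalErasure α c (b.2 / (q : ℝ) ^ n) (σ.gridAnswer q b n k) := by
    intro n k
    obtain ⟨κ, hκ, rfl⟩ := exists_branch hq0 (n := n) (k := k)
    rw [← σ.answer_gridBall b hκ]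
    exact (hσ _ (isLegalBobPlay_gridBall (by omega) hb hρ hβ hκ)).1 n
  have hQ16 : 16 ≤ q ^ N := by
    calc 16 = 4 ^ 2 := by norm_num
      _ ≤ q ^ 2 := Nat.pow_le_pow_left hq 2
      _ ≤ q ^ N := Nat.pow_le_pow_right hq0 hN2
  have hdim := le_dimH_treeLimitSet (Q := q ^ N) (M := q ^ N / 4) (by omega) (by omega) hb
    (smallPotential_zero q N b c (1 / 8) (σ.gridAnswer q b))
    (exists_children_smallPotential hq0 hb hα (by norm_num) hc0 hc1
      (fun n k _ => (hlegal n k).2.1) (fun n k _ => (hlegal n k).2.2.1 hc0)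
      (large_potential_bound_le_half (by omega) hα hα1 hc0 hc1 hN hN' hαc))
  refine le_trans (ENNReal.ofReal_le_ofReal ?_) (hdim.trans (dimH_mono
    (treeLimitSet_smallPotential_subset (by omega) (by omega) hb hρ hβ hc0 (by norm_num) hσ)))
  have hqR : (4 : ℝ) ≤ q := by exact_mod_cast hq
  have hlogQ : 0 < N * Real.log q := mul_pos (by positivity) (Real.log_pos (by linarith))
  -- The constant `6` absorbs the rounding in `q ^ N / 4`, since `q ^ N ≥ 16`.
  have hM : q ^ N ≤ 6 * (q ^ N / 4) := by omega
  have hM' : ((q : ℝ) ^ N) / 6 ≤ ((q ^ N / 4 : ℕ) : ℝ) := by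
    rw [div_le_iff₀' (by norm_num)]
    exact_mod_cast hM
  rw [Nat.cast_pow, Real.log_pow, le_div_iff₀ hlogQ, sub_mul, one_mul, div_mul_cancel₀ _ hlogQ.ne',
    ← Real.log_pow, ← Real.log_div (by positivity) (by norm_num)]
  exact Real.log_le_log (by positivity) hM'

theorem mainTheorem3 (α β c ρ : ℝ) (S : Set ℝ)
    (hα : 0 < α) (hρ : 0 < ρ) (hc0 : 0 < c) (hc1 : c < 1) (hβ0 : 0 < β) (hβ : β ≤ 1 / 4)
    (hS : IsPotentialWinning α β c ρ S)
    (hαc : α ^ c ≤ (1 / 720 ^ 2) * (1 - β ^ (1 - c)))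
    (B₀ : Set ℝ) (x₀ r₀ : ℝ) (hr₀ : ρ ≤ r₀)
    (hB₀ : B₀ = Metric.closedBall x₀ r₀ ∨ B₀ = Metric.ball x₀ r₀) :
    0 < 1 - 1440 * α * Real.log 6 / |Real.log β| ∧
      ENNReal.ofReal (1 - 1440 * α * Real.log 6 / |Real.log β|) ≤ dimH (S ∩ B₀) := by
  have hac0 : 0 < α ^ c := by positivity
  have hu0 : 0 < β ^ (1 - c) := by positivity
  have hαc' : 720 ^ 2 * α ^ c ≤ 1 - β ^ (1 - c) := by
    rw [one_div, inv_mul_eq_div, le_div_iff₀' (by norm_num)] at hαc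
    exact hαc
  have hα1 : α ≤ 1 := by
    by_contra! h
    have := Real.one_le_rpow h.le hc0.le
    linarith
  have hαa : α ≤ α ^ c := by
    conv_lhs => rw [← Real.rpow_one α]
    exact Real.rpow_le_rpow_of_exponent_ge hα hα1 hc1.le
  have hα' : 720 ^ 2 * α ≤ 1 := by linarith
  have hlogβ : Real.log β < 0 := Real.log_neg hβ0 (by linarith)
  have hlog6 : 0 < Real.log 6 := Real.log_pos (by norm_num)
  have hlog6' : Real.log 6 ≤ 5 := by
    linarith [Real.log_le_sub_one_of_pos (show (0 : ℝ) < 6 by norm_num)]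
  have habs : |Real.log β| = -Real.log β := abs_of_neg hlogβ
  -- From `1 - β ^ (1 - c) ≤ (1 - c) |log β| ≤ |log β|`. Positivity of the bound follows, as `1440
  -- log 6 ≤ 7200 < 720 ^ 2`.
  have hL : 720 ^ 2 * α ≤ |Real.log β| := by
    have h1 := Real.add_one_le_exp (Real.log β * (1 - c))
    rw [← Real.rpow_def_of_pos hβ0] at h1
    rw [habs]
    nlinarith
  have hL0 : 0 < |Real.log β| := by rw [habs]; linarith
  refine ⟨?_, ?_⟩
  · rw [sub_pos, div_lt_one hL0]
    nlinarith
  set q := ⌊1 / β⌋₊ with hq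
  have hq4 : 4 ≤ q := Nat.le_floor (by rw [le_div_iff₀ hβ0]; push_cast; linarith)
  have hq4R : (4 : ℝ) ≤ q := by exact_mod_cast hq4
  have hqβ : β * q ≤ 1 := by
    have := Nat.floor_le (show 0 ≤ 1 / β by positivity)
    rwa [le_div_iff₀ hβ0, mul_comm] at this
  -- Rounding `1 / β` down costs at most a square, because `q + 1 ≤ q ^ 2`.
  have hq2 : 1 / β ≤ (q : ℝ) ^ 2 := by
    have := (Nat.lt_floor_add_one (1 / β)).le
    rw [← hq] at this
    nlinarith
  set N := ⌊1 / (8 * α)⌋₊ with hN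
  have hN1 : N * α ≤ 1 / 8 := by
    have := Nat.floor_le (show 0 ≤ 1 / (8 * α) by positivity)
    rw [← hN, le_div_iff₀ (by positivity)] at this
    linarith
  have hN2 : 1 / 8 < N * α + α := by
    have := Nat.lt_floor_add_one (1 / (8 * α))
    rw [← hN, div_lt_iff₀ (by positivity)] at this
    linarith
  have hN3 : 1 / 16 ≤ N * α := by linarith
  have hN4 : 2 ≤ N := Nat.le_floor (by rw [le_div_iff₀ (by positivity)]; push_cast; linarith)
  -- With `v = q ^ (c - 1)`, one has `v ^ 2 ≤ β ^ (1 - c)` and `1 - v ^ 2 ≤ 2 (1 - v)`.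
  have hv : 720 ^ 2 * α ^ c ≤ 2 * (1 - (q : ℝ) ^ (c - 1)) := by
    have hv0 : 0 < (q : ℝ) ^ (c - 1) := by positivity
    have h1 : ((q : ℝ) ^ (c - 1)) ^ 2 ≤ β ^ (1 - c) := by
      calc ((q : ℝ) ^ (c - 1)) ^ 2 = ((q : ℝ) ^ 2) ^ (c - 1) := by
            rw [← Real.rpow_natCast, ← Real.rpow_mul (by positivity), mul_comm,
              Real.rpow_mul (by positivity), Real.rpow_natCast]
        _ ≤ (1 / β) ^ (c - 1) :=
            Real.rpow_le_rpow_of_nonpos (by positivity) hq2 (by linarith)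
        _ = β ^ (1 - c) := by
            rw [one_div, Real.inv_rpow hβ0.le, ← Real.rpow_neg hβ0.le]; congr 1; ring
    nlinarith [sq_nonneg (1 - (q : ℝ) ^ (c - 1))]
  have hlogq : |Real.log β| ≤ 2 * Real.log q := by
    have h1 := Real.log_le_log (by positivity) hq2
    rw [Real.log_pow, one_div, Real.log_inv] at h1
    rw [habs]
    exact_mod_cast h1
  have hfinal : 1 - 1440 * α * Real.log 6 / |Real.log β| ≤ 1 - Real.log 6 / (N * Real.log q) := by
    have hlq : 0 < Real.log q := Real.log_pos (by linarith)
    have hN0 : (0 : ℝ) < N := by positivity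
    apply sub_le_sub_left
    rw [div_le_div_iff₀ (by positivity) hL0]
    -- Only `|log β| ≤ 2 log q` and `N α ≥ 1 / 16` are needed, so `32` in place of `1440` would
    -- already suffice.
    have h1 : |Real.log β| ≤ 1440 * α * (N * Real.log q) := by
      calc |Real.log β| ≤ 1440 * (1 / 16) * Real.log q := by linarith
        _ ≤ 1440 * (N * α) * Real.log q := by gcongr
        _ = _ := by ring
    nlinarith [mul_le_mul_of_nonneg_left h1 hlog6.le]
  have hclosed := le_dimH_of_isPotentialWinning (b := (x₀, r₀)) (hρ.trans_le hr₀) hr₀ hα hc0 hc1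
    hS hq4 hqβ hN4 hα1 hN1 hN3 hv
  refine (ENNReal.ofReal_le_ofReal hfinal).trans (hclosed.trans ?_)
  rcases hB₀ with rfl | rfl
  · exact le_rfl
  · exact dimH_inter_closedBall_le S x₀ r₀
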